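/- **Lemma 3.9.** Let $0<\gamma<1$, let $a<b$ and $c<d$ be real numbers, and let $u\in C^6([a,b]\times[c,d])$. For integers $M_x,M_y\ge 1$ put $h_x=(b-a)/M_x$, $h_y=(d-c)/M_y$, $x_{k/2}=a+\tfrac k2 h_x$ $(0\le k\le 2M_x)$ and $y_{k/2}=c+\tfrac k2 h_y$ $(0\le k\le 2M_y)$. For $x\in[a,b]$ let $$\phi_l(x)=\begin{cases}\dfrac{(x-x_{l-1})\,(2x-x_l-x_{l-1})}{h_x^2}, & x\in[x_{l-1},x_l],\ l\ge 1,\\[1ex] \dfrac{(x_{l+1}-x)\,(x_{l+1}+x_l-2x)}{h_x^2}, & x\in[x_l,x_{l+1}],\ l\le M_x-1,\\[1ex] 0,&\text{otherwise,}\end{cases}\qquad 0\le l\le M_x,$$ $$\phi_{l-\frac12}(x)=\begin{cases}\dfrac{4(x-x_{l-1})(x_l-x)}{h_x^2}, & x\in[x_{l-1},x_l],\\[1ex] 0,&\text{otherwise,}\end{cases}\qquad 1\le l\le M_x,$$ let $\tilde\phi_{r/2}(y)$, $0\le r\le 2M_y$, be the analogous functions on $[c,d]$ for the mesh points $y_{r/2}$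 and step $h_y$, and let $$u_Q(x,y)=\sum_{l=0}^{2M_x}\sum_{r=0}^{2M_y}\phi_{l/2}(x)\,\tilde\phi_{r/2}(y)\,u(x_{l/2},y_{r/2})$$ be the piecewise biquadratic Lagrange interpolant of $u$. Then there is a constant $C$, depending only on $\gamma,a,b,c,d$ and $u$, such that for all $M_x,M_y\ge1$, all $1\le i\le 2M_x-1$ and all $1\le j\le 2M_y-1$, the function $(x,y)\mapsto \dfrac{u(x,y)-u_Q(x,y)}{|x_{i/2}-x|^\gamma|y_{j/2}-y|^\gamma}$ is integrable on $[a,b]\times[c,d]$ and $$\left|\int_c^d\!\int_a^b \frac{u(x,y)-u_Q(x,y)}{|x_{i/2}-x|^{\gamma}\,|y_{j/2}-y|^{\gamma}}\,dx\,dy\right|\le C\left(h_x^4\,\eta_{i/2}^{-\gamma}+h_y^4\,\tilde\eta_{j/2}^{-\gamma}\right)+C\left(h_x^{5-\gamma}+h_y^{5-\gamma}\right),$$ where $\eta_{i/2}=\min\{x_{i/2}-a,\;b-x_{i/2}\}$ and $\tilde\eta_{j/2}=\min\{y_{j/2}-c,\;d-y_{j/2}\}$. -/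

import Mathlib

noncomputable section

namespace PQC

/-- Uniform step size `h = (b - a) / M`. -/
def step (a b : ℝ) (M : ℕ) : ℝ := (b - a) / M

/-- The mesh point `x_{k/2} = a + (k/2) h`, for `0 ≤ k ≤ 2M`. -/
def node (a b : ℝ) (M k : ℕ) : ℝ := a + (k : ℝ) / 2 * step a b M

open Classical in
/-- The piecewise quadratic basis function `φ_{k/2}`, `0 ≤ k ≤ 2M`, attached to the mesh point
`p = x_{k/2}`. For `k = 2l` the neighbours are `x_{l-1} = p - h` and `x_{l+1} = p + h`; for
`k = 2l - 1` the two ends of the element are `x_{l-1} = p - h/2` and `x_l = p + h/2`.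
For `k = 0` and `k = 2M` only the half of the support that lies in `[a, b]` matters. -/
def basisFun (a b : ℝ) (M k : ℕ) (x : ℝ) : ℝ :=
  let h := step a b M
  let p := node a b M k
  if Even k then
    if x ∈ Set.Icc (p - h) p then
      (x - (p - h)) / h * ((2 * x - (p + (p - h))) / h)
    else if x ∈ Set.Icc p (p + h) then
      ((p + h) - x) / h * (((p + h) + p - 2 * x) / h)
    else 0
  else
    if x ∈ Set.Icc (p - h / 2) (p + h / 2) then
      4 * (x - (p - h / 2)) * ((p + h / 2) - x) / h ^ 2
    else 0

/-- The piecewise biquadratic Lagrange interpolant `u_Q` of `u` on `[a, b] × [c, d]`. -/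
def interp (a b c d : ℝ) (Mx My : ℕ) (u : ℝ → ℝ → ℝ) (x y : ℝ) : ℝ :=
  ∑ l ∈ Finset.range (2 * Mx + 1), ∑ r ∈ Finset.range (2 * My + 1),
    basisFun a b Mx l x * basisFun c d My r y * u (node a b Mx l) (node c d My r)

/-- `η_{k/2} = min {x_{k/2} - a, b - x_{k/2}}`. -/
def eta (a b : ℝ) (M k : ℕ) : ℝ := min (node a b M k - a) (b - node a b M k)

/-- The weighted interpolation error
`(u - u_Q)(x, y) / (|x_{i/2} - x| ^ γ * |y_{j/2} - y| ^ γ)`. -/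
def errIntegrand (γ a b c d : ℝ) (u : ℝ → ℝ → ℝ) (Mx My i j : ℕ) (x y : ℝ) : ℝ :=
  (u x y - interp a b c d Mx My u x y) /
    (|node a b Mx i - x| ^ γ * |node c d My j - y| ^ γ)

end PQC

end

namespace PQC
open MeasureTheory Set

/-! The problem reduces to one variable. There, on an element with midpoint `m`, the quadratic
interpolation error of `g` is `g'''(m) / 6` times the cubic `bubble`, up to `O(h ^ 4)`. Taken in
absolute value the cubic term would give only `O(h ^ 3)`; the fourth order comes from cancellation
against the weight.

The bubble has mean zero, so its weighted moment on an element off the singularity `ξ` sees only the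
oscillation of the weight (`abs_bubbleMoment_le_sub`). This makes `|m - ξ|` times the moment `O(h ^
4)` times the integral of the weight (`abs_sub_mul_bubbleMoment_le`), so `g'''(m)` may be replaced
by `g'''(ξ)` on every element. What remains is `g'''(ξ) / 6` times the sum of all moments. Since `ξ`
is a node or a midpoint, elements symmetric about `ξ` cancel; the others lie on one side and their
bounds telescope to `h ^ 4 * η ^ (-γ)` (`abs_sum_bubbleMoment_le`). As `η ≤ b - a`, plain `O(h ^ 4)`
terms are absorbed too.

In two variables, `u - u_Q = (u - I_x u) + I_x (u - I_y u)`. The first term is a one-variable error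
for each `y`; the second is a combination of one-variable errors in `y` at the nodes in `x`,
controlled by the bounded Lebesgue constant of `I_x`. -/

/-! ### The singular weight. -/

lemma intervalIntegrable_abs_rpow {γ : ℝ} (hγ : γ < 1) (p q : ℝ) :
    IntervalIntegrable (fun x : ℝ => |x| ^ (-γ)) volume p q := by
  have pos : ∀ c : ℝ, 0 ≤ c → IntervalIntegrable (fun x : ℝ => |x| ^ (-γ)) volume 0 c := by
    intro c hc
    refine (intervalIntegral.intervalIntegrable_rpow' (r := -γ) (by linarith)).congr ?_
    intro x hx
    rw [uIoc_of_le hc] at hx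
    simp only [abs_of_pos hx.1]
  have all : ∀ c : ℝ, IntervalIntegrable (fun x : ℝ => |x| ^ (-γ)) volume 0 c := by
    intro c
    rcases le_total 0 c with hc | hc
    · exact pos c hc
    · have := (pos (-c) (by linarith)).comp_sub_left 0
      simpa using this
  exact (all p).symm.trans (all q)

/-- The singular weight `x ↦ |ξ - x| ^ (-γ)`. -/
noncomputable def weight (γ ξ x : ℝ) : ℝ := |ξ - x| ^ (-γ)

lemma weight_nonneg (γ ξ x : ℝ) : 0 ≤ weight γ ξ x := Real.rpow_nonneg (abs_nonneg _) _

lemma weight_intervalIntegrable {γ : ℝ} (hγ : γ < 1) (ξ p q : ℝ) :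
    IntervalIntegrable (weight γ ξ) volume p q := by
  have := (intervalIntegrable_abs_rpow hγ (ξ - p) (ξ - q)).comp_sub_left ξ
  simp only [sub_sub_cancel] at this
  exact this

lemma weight_reflect (γ ξ x : ℝ) : weight γ ξ (2 * ξ - x) = weight γ ξ x := by
  unfold weight
  rw [show ξ - (2 * ξ - x) = -(ξ - x) by ring, abs_neg]

lemma weight_anti {γ ξ x y : ℝ} (hγ : 0 < γ) (hx : ξ < x) (hxy : x ≤ y) :
    weight γ ξ y ≤ weight γ ξ x := by
  unfold weight
  rw [abs_sub_comm ξ y, abs_sub_comm ξ x, abs_of_pos (by linarith), abs_of_pos (by linarith)]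
  exact Real.rpow_le_rpow_of_nonpos (by linarith) (by linarith) (by linarith)

lemma integral_weight_nonneg {γ ξ p q : ℝ} (hpq : p ≤ q) : 0 ≤ ∫ x in p..q, weight γ ξ x :=
  intervalIntegral.integral_nonneg hpq fun _ _ => weight_nonneg _ _ _

/-- The substitution `s = ξ - x` sends `[a, b]` into `[-(b - a), b - a]`, which gives a bound free
of `ξ`. -/
lemma integral_weight_le {γ : ℝ} (hγ : γ < 1) {a b ξ : ℝ} (hξ : ξ ∈ Icc a b) :
    ∫ x in a..b, weight γ ξ x ≤ ∫ s in (-(b - a))..(b - a), |s| ^ (-γ) := by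
  have h := intervalIntegral.integral_comp_sub_left (a := a) (b := b)
    (fun s : ℝ => |s| ^ (-γ)) ξ
  unfold weight
  rw [h]
  refine intervalIntegral.integral_mono_interval (by linarith [hξ.1]) (by linarith [hξ.1, hξ.2])
    (by linarith [hξ.2]) (Filter.Eventually.of_forall fun s => ?_)
    (intervalIntegrable_abs_rpow hγ _ _)
  exact Real.rpow_nonneg (abs_nonneg _) _

/-! ### Weighted moments of the bubble on one element. -/

/-- The cubic with zeros at the ends and at the midpoint of `[p, p + h]`. -/
noncomputable def bubble (p h x : ℝ) : ℝ := (x - p) * (x - (p + h / 2)) * (x - (p + h))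

lemma continuous_bubble (p h : ℝ) : Continuous (bubble p h) := by unfold bubble; fun_prop

lemma abs_bubble_le {p h x : ℝ} (hx : x ∈ Icc p (p + h)) : |bubble p h x| ≤ h ^ 3 := by
  obtain ⟨h1, h2⟩ := hx
  have e1 : |x - p| ≤ h := abs_le.mpr ⟨by linarith, by linarith⟩
  have e2 : |x - (p + h / 2)| ≤ h := abs_le.mpr ⟨by linarith, by linarith⟩
  have e3 : |x - (p + h)| ≤ h := abs_le.mpr ⟨by linarith, by linarith⟩
  have h0 : 0 ≤ h := by linarith
  unfold bubble
  rw [abs_mul, abs_mul]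
  calc _ ≤ h * h * h := by gcongr
    _ = h ^ 3 := by ring

lemma integral_bubble (p h : ℝ) : ∫ x in p..p + h, bubble p h x = 0 := by
  -- This antiderivative vanishes at both ends.
  have key : ∀ x ∈ uIcc p (p + h),
      HasDerivAt (fun x => ((x - p) * (x - (p + h))) ^ 2 / 4) (bubble p h x) x := by
    intro x _
    have h1 := (((hasDerivAt_id x).sub_const p).mul
      ((hasDerivAt_id x).sub_const (p + h))).pow 2 |>.div_const 4
    refine h1.congr_deriv ?_
    simp [bubble]
    ring
  rw [intervalIntegral.integral_eq_sub_of_hasDerivAt key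
    ((continuous_bubble p h).intervalIntegrable _ _)]
  ring

lemma bubble_mul_weight_intervalIntegrable {γ : ℝ} (hγ : γ < 1) (ξ p h r s : ℝ) :
    IntervalIntegrable (fun x => bubble p h x * weight γ ξ x) volume r s :=
  (weight_intervalIntegrable hγ ξ r s).continuousOn_mul (continuous_bubble p h).continuousOn

/-- The weighted integral of `bubble p h` over `[p, p + h]`. -/
noncomputable def bubbleMoment (γ ξ h p : ℝ) : ℝ := ∫ x in p..p + h, bubble p h x * weight γ ξ x

/-- Reflection about `ξ` preserves the weight and carries one bubble to minus the other. -/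
lemma bubbleMoment_reflect (γ ξ h p : ℝ) :
    bubbleMoment γ ξ h (2 * ξ - p - h) = -bubbleMoment γ ξ h p := by
  have e := intervalIntegral.integral_comp_sub_left (a := p) (b := p + h)
    (fun x => bubble (2 * ξ - p - h) h x * weight γ ξ x) (2 * ξ)
  unfold bubbleMoment
  rw [show 2 * ξ - p - h + h = 2 * ξ - p by ring,
    show (2 * ξ - p - h) = 2 * ξ - (p + h) by ring]
  rw [show (2 * ξ - p - h) = 2 * ξ - (p + h) by ring] at e
  rw [← e, ← intervalIntegral.integral_neg]
  refine intervalIntegral.integral_congr fun x _ => ?_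
  simp only [weight_reflect, bubble]
  ring

lemma integral_weight_reflect (γ ξ h p : ℝ) :
    ∫ x in (2 * ξ - p - h)..(2 * ξ - p - h + h), weight γ ξ x = ∫ x in p..p + h, weight γ ξ x := by
  have e := intervalIntegral.integral_comp_sub_left (a := p) (b := p + h)
    (fun x => weight γ ξ x) (2 * ξ)
  rw [show 2 * ξ - p - h + h = 2 * ξ - p by ring,
    show (2 * ξ - p - h) = 2 * ξ - (p + h) by ring, ← e]
  simp only [weight_reflect]

lemma abs_bubbleMoment_le {γ : ℝ} (hγ : γ < 1) {h : ℝ} (hh : 0 ≤ h) (ξ p : ℝ) :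
    |bubbleMoment γ ξ h p| ≤ h ^ 3 * ∫ x in p..p + h, weight γ ξ x := by
  rw [← intervalIntegral.integral_const_mul, ← Real.norm_eq_abs]
  refine intervalIntegral.norm_integral_le_of_norm_le (by linarith)
    (Filter.Eventually.of_forall fun x hx => ?_) ((weight_intervalIntegrable hγ ξ _ _).const_mul _)
  rw [Real.norm_eq_abs, abs_mul, abs_of_nonneg (weight_nonneg _ _ _)]
  exact mul_le_mul_of_nonneg_right (abs_bubble_le ⟨hx.1.le, hx.2⟩) (weight_nonneg _ _ _)

/-- Mean zero allows the constant `weight γ ξ p` to be subtracted from the weight, which is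
decreasing to the right of `ξ`. The bound is a difference of endpoint values so that it can
telescope. -/
lemma abs_bubbleMoment_le_sub {γ : ℝ} (hγ0 : 0 < γ) (hγ : γ < 1) {h ξ p : ℝ} (hh : 0 ≤ h)
    (hp : ξ < p) :
    |bubbleMoment γ ξ h p| ≤ h ^ 4 * (weight γ ξ p - weight γ ξ (p + h)) := by
  have e : bubbleMoment γ ξ h p =
      ∫ x in p..p + h, bubble p h x * (weight γ ξ x - weight γ ξ p) := by
    simp only [mul_sub]
    rw [intervalIntegral.integral_sub (bubble_mul_weight_intervalIntegrable hγ _ _ _ _ _)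
      (Continuous.intervalIntegrable (by have := continuous_bubble p h; fun_prop) _ _),
      intervalIntegral.integral_mul_const, integral_bubble, bubbleMoment]
    ring
  rw [e, ← Real.norm_eq_abs]
  refine (intervalIntegral.norm_integral_le_of_norm_le_const
    (C := h ^ 3 * (weight γ ξ p - weight γ ξ (p + h))) fun x hx => ?_).trans_eq ?_
  · rw [uIoc_of_le (by linarith)] at hx
    have h1 := weight_anti hγ0 hp hx.1.le
    have h2 := weight_anti hγ0 (hp.trans hx.1) hx.2
    rw [Real.norm_eq_abs, abs_mul]
    refine mul_le_mul (abs_bubble_le ⟨hx.1.le, hx.2⟩) ?_ (abs_nonneg _) (by positivity)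
    rw [abs_le]
    constructor <;> linarith
  · rw [add_sub_cancel_left, abs_of_nonneg hh]; ring

/-- Off the singularity by at least `h / 2`, the oscillation of the weight over an element is
controlled by its mean. -/
lemma mul_weight_sub_le {γ : ℝ} (hγ0 : 0 < γ) (hγ : γ < 1) {h ξ p : ℝ} (hh : 0 ≤ h)
    (hp : ξ < p) (hph : h / 2 ≤ p - ξ) :
    (p + h - ξ) * (weight γ ξ p - weight γ ξ (p + h)) ≤ 3 * ∫ x in p..p + h, weight γ ξ x := by
  have lower : h * weight γ ξ (p + h) ≤ ∫ x in p..p + h, weight γ ξ x := by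
    have := intervalIntegral.integral_mono_on (a := p) (b := p + h) (by linarith)
      (intervalIntegrable_const (μ := volume) (c := weight γ ξ (p + h)))
      (weight_intervalIntegrable hγ ξ _ _)
      (fun x hx => weight_anti hγ0 (by linarith [hx.1] : ξ < x) hx.2)
    simpa using this
  refine le_trans ?_ (mul_le_mul_of_nonneg_left lower (by norm_num))
  set ρ := p - ξ with hρ
  have hρ0 : 0 < ρ := by linarith
  have hw : weight γ ξ p = ((ρ + h) / ρ) ^ γ * weight γ ξ (p + h) := by
    unfold weight
    rw [abs_sub_comm ξ p, abs_sub_comm ξ (p + h), abs_of_pos hρ0,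
      show p + h - ξ = ρ + h by ring, abs_of_pos (by linarith : 0 < ρ + h),
      Real.div_rpow (by linarith) hρ0.le, Real.rpow_neg hρ0.le, Real.rpow_neg (by linarith)]
    have : (ρ + h) ^ γ ≠ 0 := (Real.rpow_pos_of_pos (by linarith) _).ne'
    field_simp
  have hr : 1 ≤ (ρ + h) / ρ := by rw [le_div_iff₀ hρ0]; linarith
  -- The base is at least 1 and `γ < 1`.
  have hrγ : ((ρ + h) / ρ) ^ γ ≤ (ρ + h) / ρ := by
    simpa using Real.rpow_le_rpow_of_exponent_le hr hγ.le
  -- The 3 comes from `h ≤ 2 * ρ`, hence `ρ + h ≤ 3 * ρ`.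
  have h3 : (ρ + h) * ((ρ + h) / ρ - 1) ≤ 3 * h := by
    have : (ρ + h) * ((ρ + h) / ρ - 1) = (ρ + h) * h / ρ := by field_simp; ring
    rw [this, div_le_iff₀ hρ0]
    nlinarith
  have w0 := weight_nonneg γ ξ (p + h)
  rw [hw, show p + h - ξ = ρ + h by ring]
  calc (ρ + h) * (((ρ + h) / ρ) ^ γ * weight γ ξ (p + h) - weight γ ξ (p + h))
      = (ρ + h) * (((ρ + h) / ρ) ^ γ - 1) * weight γ ξ (p + h) := by ring
    _ ≤ (ρ + h) * ((ρ + h) / ρ - 1) * weight γ ξ (p + h) := by gcongr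
    _ ≤ 3 * h * weight γ ξ (p + h) := by gcongr
    _ = _ := by ring

lemma abs_sub_mul_bubbleMoment_le_right {γ : ℝ} (hγ0 : 0 < γ) (hγ : γ < 1) {h ξ p : ℝ}
    (hh : 0 < h) (hph : h / 2 ≤ p - ξ) :
    |p + h / 2 - ξ| * |bubbleMoment γ ξ h p| ≤ 3 * h ^ 4 * ∫ x in p..p + h, weight γ ξ x := by
  have hp : ξ < p := by linarith
  have h1 := abs_bubbleMoment_le_sub hγ0 hγ hh.le hp
  have h2 := mul_weight_sub_le hγ0 hγ hh.le hp hph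
  rw [abs_of_pos (by linarith : 0 < p + h / 2 - ξ)]
  calc (p + h / 2 - ξ) * |bubbleMoment γ ξ h p|
      ≤ (p + h - ξ) * (h ^ 4 * (weight γ ξ p - weight γ ξ (p + h))) := by
        gcongr <;> linarith
    _ = h ^ 4 * ((p + h - ξ) * (weight γ ξ p - weight γ ξ (p + h))) := by ring
    _ ≤ h ^ 4 * (3 * ∫ x in p..p + h, weight γ ξ x) := by gcongr
    _ = _ := by ring

/-- The factor `|p + h / 2 - ξ|` is the price of moving a Lipschitz third derivative from the
midpoint to `ξ`. If `ξ` is in the element that factor is at most `h`; an element to the left is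
reflected to the right. -/
lemma abs_sub_mul_bubbleMoment_le {γ : ℝ} (hγ0 : 0 < γ) (hγ : γ < 1) {h ξ p : ℝ} (hh : 0 < h)
    (hpos : ξ ∈ Icc p (p + h) ∨ h / 2 ≤ p - ξ ∨ h / 2 ≤ ξ - (p + h)) :
    |p + h / 2 - ξ| * |bubbleMoment γ ξ h p| ≤ 3 * h ^ 4 * ∫ x in p..p + h, weight γ ξ x := by
  rcases hpos with hξ | hr | hl
  · have h1 : |p + h / 2 - ξ| ≤ h := abs_le.mpr ⟨by linarith [hξ.2], by linarith [hξ.1]⟩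
    have h0 := integral_weight_nonneg (γ := γ) (ξ := ξ) (by linarith : p ≤ p + h)
    have h2 := abs_bubbleMoment_le hγ hh.le ξ p
    calc _ ≤ h * (h ^ 3 * ∫ x in p..p + h, weight γ ξ x) := by gcongr
      _ = 1 * h ^ 4 * ∫ x in p..p + h, weight γ ξ x := by ring
      _ ≤ _ := by gcongr; norm_num
  · exact abs_sub_mul_bubbleMoment_le_right hγ0 hγ hh hr
  · have := abs_sub_mul_bubbleMoment_le_right hγ0 hγ (ξ := ξ) (p := 2 * ξ - p - h) hh
      (by linarith)
    rwa [bubbleMoment_reflect, integral_weight_reflect, abs_neg,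
      show 2 * ξ - p - h + h / 2 - ξ = -(p + h / 2 - ξ) by ring, abs_neg] at this

/-! ### The mesh, the quadratic basis and its Lebesgue constant. -/

lemma step_pos {a b : ℝ} {M : ℕ} (hab : a < b) (hM : 1 ≤ M) : 0 < step a b M := by
  have : (0 : ℝ) < M := by exact_mod_cast hM
  exact div_pos (by linarith) this

lemma mul_step {a b : ℝ} {M : ℕ} (hM : 1 ≤ M) : (M : ℝ) * step a b M = b - a := by
  have : (M : ℝ) ≠ 0 := by positivity
  unfold step; field_simp

lemma node_two_mul (a b : ℝ) (M l : ℕ) : node a b M (2 * l) = a + l * step a b M := by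
  unfold node; push_cast; ring

lemma node_mem_Icc {a b : ℝ} {M k : ℕ} (hab : a < b) (hM : 1 ≤ M) (hk : k ≤ 2 * M) :
    node a b M k ∈ Icc a b := by
  have h := step_pos hab hM
  have e := mul_step (a := a) (b := b) hM
  have : (k : ℝ) ≤ 2 * M := by exact_mod_cast hk
  have k0 : (0 : ℝ) ≤ k := by positivity
  constructor <;> unfold node <;> nlinarith

lemma measurable_basisFun (a b : ℝ) (M k : ℕ) : Measurable (basisFun a b M k) := by
  unfold basisFun
  dsimp only
  split_ifs
  · exact Measurable.ite measurableSet_Icc (by fun_prop)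
      (Measurable.ite measurableSet_Icc (by fun_prop) measurable_const)
  · exact Measurable.ite measurableSet_Icc (by fun_prop) measurable_const

lemma basisFun_even_right {a b : ℝ} {M k : ℕ} (hk : Even k) (h : 0 < step a b M) {t : ℝ}
    (ht : t ∈ Icc (0 : ℝ) 1) :
    basisFun a b M k (node a b M k + t * step a b M) = (1 - t) * (1 - 2 * t) := by
  obtain ⟨t0, t1⟩ := ht
  unfold basisFun
  dsimp only
  rw [if_pos hk]
  split_ifs with h1 h2
  · have : t = 0 := by
      have := h1.2
      nlinarith
    subst this
    field_simp
    ring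
  · field_simp
    ring
  · exact absurd ⟨by nlinarith, by nlinarith⟩ h2

lemma basisFun_even_left {a b : ℝ} {M k : ℕ} (hk : Even k) (h : 0 < step a b M) {t : ℝ}
    (ht : t ∈ Icc (0 : ℝ) 1) :
    basisFun a b M k (node a b M k - step a b M + t * step a b M) = t * (2 * t - 1) := by
  obtain ⟨t0, t1⟩ := ht
  unfold basisFun
  dsimp only
  rw [if_pos hk, if_pos ⟨by nlinarith, by nlinarith⟩]
  field_simp
  ring

lemma basisFun_odd {a b : ℝ} {M k : ℕ} (hk : ¬ Even k) (h : 0 < step a b M) {t : ℝ}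
    (ht : t ∈ Icc (0 : ℝ) 1) :
    basisFun a b M k (node a b M k - step a b M / 2 + t * step a b M) = 4 * t * (1 - t) := by
  obtain ⟨t0, t1⟩ := ht
  unfold basisFun
  dsimp only
  rw [if_neg hk, if_pos ⟨by nlinarith, by nlinarith⟩]
  field_simp
  ring

lemma basisFun_eq_zero_even {a b : ℝ} {M k : ℕ} (hk : Even k) {x : ℝ}
    (hx : step a b M ≤ |x - node a b M k|) : basisFun a b M k x = 0 := by
  unfold basisFun
  dsimp only
  rw [if_pos hk]
  split_ifs with h1 h2
  · rw [abs_of_nonpos (by linarith [h1.2])] at hx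
    have : x = node a b M k - step a b M := le_antisymm (by linarith) h1.1
    rw [this]; simp
  · rw [abs_of_nonneg (by linarith [h2.1])] at hx
    have : x = node a b M k + step a b M := le_antisymm h2.2 (by linarith)
    rw [this]; simp
  · rfl

lemma basisFun_eq_zero_odd {a b : ℝ} {M k : ℕ} (hk : ¬ Even k) {x : ℝ}
    (hx : step a b M / 2 ≤ |x - node a b M k|) : basisFun a b M k x = 0 := by
  unfold basisFun
  dsimp only
  rw [if_neg hk]
  split_ifs with h1
  · rcases le_abs.mp hx with h | h
    · have : x = node a b M k + step a b M / 2 := le_antisymm h1.2 (by linarith)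
      rw [this]; simp
    · have : x = node a b M k - step a b M / 2 := le_antisymm (by linarith) h1.1
      rw [this]; simp
  · rfl

/-- The Lagrange sum restricted to one element has three terms. -/
lemma sum_basisFun_mul {a b : ℝ} {M l : ℕ} (h : 0 < step a b M) (hl : l < M) {t : ℝ}
    (ht : t ∈ Icc (0 : ℝ) 1) (F : ℕ → ℝ) :
    ∑ k ∈ Finset.range (2 * M + 1),
        basisFun a b M k (a + l * step a b M + t * step a b M) * F k =
      (1 - t) * (1 - 2 * t) * F (2 * l) + 4 * t * (1 - t) * F (2 * l + 1) +
        t * (2 * t - 1) * F (2 * l + 2) := by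
  set x := a + l * step a b M + t * step a b M with hx
  have e0 : basisFun a b M (2 * l) x = (1 - t) * (1 - 2 * t) := by
    rw [← basisFun_even_right (even_two_mul l) h ht, node_two_mul]
  have e1 : basisFun a b M (2 * l + 1) x = 4 * t * (1 - t) := by
    rw [← basisFun_odd (k := 2 * l + 1) (by simp) h ht]
    congr 1
    unfold node; push_cast; rw [hx]; ring
  have e2 : basisFun a b M (2 * l + 2) x = t * (2 * t - 1) := by
    rw [← basisFun_even_left (k := 2 * l + 2) (by simp [Nat.even_add]) h ht]
    congr 1
    unfold node; push_cast; rw [hx]; ring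
  have sub : ({2 * l, 2 * l + 1, 2 * l + 2} : Finset ℕ) ⊆ Finset.range (2 * M + 1) := by
    intro k hk
    simp only [Finset.mem_insert, Finset.mem_singleton] at hk
    rw [Finset.mem_range]; omega
  rw [← Finset.sum_subset sub, Finset.sum_insert (by simp), Finset.sum_insert (by simp),
    Finset.sum_singleton, e0, e1, e2]
  · ring
  intro k _ hk
  simp only [Finset.mem_insert, Finset.mem_singleton, not_or] at hk
  obtain ⟨t0, t1⟩ := ht
  have dist : x - node a b M k = (l + t - k / 2) * step a b M := by
    unfold node; rw [hx]; ring
  suffices basisFun a b M k x = 0 by rw [this, zero_mul]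
  -- Even indices have the wider support, but parity keeps them one further half step away: `k ≤ 2l
  -- - 2` on the left, `k ≥ 2l + 4` on the right.
  rcases Nat.lt_or_ge k (2 * l) with hlt | hge
  · have hk1 : (k : ℝ) + 1 ≤ 2 * l := by exact_mod_cast hlt
    by_cases he : Even k
    · apply basisFun_eq_zero_even he
      obtain ⟨r, rfl⟩ := he
      have : (r : ℝ) + 1 ≤ l := by exact_mod_cast (by omega : r + 1 ≤ l)
      rw [dist]
      refine le_trans ?_ (le_abs_self _)
      push_cast
      nlinarith
    · apply basisFun_eq_zero_odd he
      rw [dist]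
      refine le_trans ?_ (le_abs_self _)
      nlinarith
  · by_cases he : Even k
    · apply basisFun_eq_zero_even he
      obtain ⟨r, rfl⟩ := he
      have : (l : ℝ) + 2 ≤ r := by exact_mod_cast (by omega : l + 2 ≤ r)
      rw [dist]
      refine le_trans ?_ (neg_le_abs _)
      push_cast
      nlinarith
    · apply basisFun_eq_zero_odd he
      have : 2 * (l : ℝ) + 3 ≤ k := by exact_mod_cast (by omega : 2 * l + 3 ≤ k)
      rw [dist]
      refine le_trans ?_ (neg_le_abs _)
      nlinarith

lemma exists_element {a b : ℝ} {M : ℕ} (hab : a < b) (hM : 1 ≤ M) {x : ℝ} (hx : x ∈ Icc a b) :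
    ∃ l < M, ∃ t ∈ Icc (0 : ℝ) 1, x = a + l * step a b M + t * step a b M := by
  have h := step_pos hab hM
  have e := mul_step (a := a) (b := b) hM
  -- At `x = b` the floor would give the nonexistent element `M`.
  rcases hx.2.eq_or_lt with rfl | hxb
  · refine ⟨M - 1, by omega, 1, by simp, ?_⟩
    push_cast [Nat.cast_sub hM]
    linarith
  · have q0 : 0 ≤ (x - a) / step a b M := div_nonneg (by linarith [hx.1]) h.le
    refine ⟨⌊(x - a) / step a b M⌋₊, ?_, Int.fract ((x - a) / step a b M),
      ⟨Int.fract_nonneg _, (Int.fract_lt_one _).le⟩, ?_⟩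
    · rw [Nat.floor_lt q0, div_lt_iff₀ h]; linarith
    · have : (⌊(x - a) / step a b M⌋₊ : ℝ) + Int.fract ((x - a) / step a b M) =
          (x - a) / step a b M := by
        rw [natCast_floor_eq_intCast_floor q0]
        exact Int.floor_add_fract _
      rw [add_assoc, ← add_mul, this]
      field_simp
      ring

lemma abs_quadratic_shape_combination_le {t B x y z : ℝ} (ht : t ∈ Icc (0 : ℝ) 1)
    (hx : |x| ≤ B) (hy : |y| ≤ B) (hz : |z| ≤ B) :
    |(1 - t) * (1 - 2 * t) * x + 4 * t * (1 - t) * y + t * (2 * t - 1) * z| ≤ 3 * B := by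
  obtain ⟨t0, t1⟩ := ht
  have b0 : |(1 - t) * (1 - 2 * t)| ≤ 1 := by rw [abs_le]; constructor <;> nlinarith
  have b1 : |4 * t * (1 - t)| ≤ 1 := by
    rw [abs_le]; constructor <;> nlinarith [sq_nonneg (2 * t - 1)]
  have b2 : |t * (2 * t - 1)| ≤ 1 := by rw [abs_le]; constructor <;> nlinarith
  refine (abs_add_three _ _ _).trans ?_
  rw [abs_mul, abs_mul _ y, abs_mul _ z]
  have m0 := mul_le_mul b0 hx (abs_nonneg _) zero_le_one
  have m1 := mul_le_mul b1 hy (abs_nonneg _) zero_le_one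
  have m2 := mul_le_mul b2 hz (abs_nonneg _) zero_le_one
  linarith

lemma abs_sum_basisFun_mul_le {a b : ℝ} {M : ℕ} (hab : a < b) (hM : 1 ≤ M) {x : ℝ}
    (hx : x ∈ Icc a b) {F : ℕ → ℝ} {B : ℝ} (hF : ∀ k ≤ 2 * M, |F k| ≤ B) :
    |∑ k ∈ Finset.range (2 * M + 1), basisFun a b M k x * F k| ≤ 3 * B := by
  obtain ⟨l, hl, t, ht, rfl⟩ := exists_element hab hM hx
  rw [sum_basisFun_mul (step_pos hab hM) hl ht]
  exact abs_quadratic_shape_combination_le ht (hF _ (by omega)) (hF _ (by omega))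
    (hF _ (by omega))

/-- Testing the interpolation bound on the signs of the basis functions at `x` gives the Lebesgue
function. -/
lemma sum_abs_basisFun_le {a b : ℝ} {M : ℕ} (hab : a < b) (hM : 1 ≤ M) {x : ℝ}
    (hx : x ∈ Icc a b) :
    ∑ k ∈ Finset.range (2 * M + 1), |basisFun a b M k x| ≤ 3 := by
  have := abs_sum_basisFun_mul_le hab hM hx (F := fun k => SignType.sign (basisFun a b M k x))
    (B := 1) (fun k _ => by
      rcases SignType.sign (basisFun a b M k x) <;> simp)
  simp only [self_mul_sign, mul_one] at this
  exact (le_abs_self _).trans this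

lemma abs_basisFun_le {a b : ℝ} {M k : ℕ} (hab : a < b) (hM : 1 ≤ M) (hk : k ≤ 2 * M) {x : ℝ}
    (hx : x ∈ Icc a b) : |basisFun a b M k x| ≤ 3 :=
  (Finset.single_le_sum (f := fun k => |basisFun a b M k x|) (fun _ _ => abs_nonneg _)
    (Finset.mem_range.mpr (by omega))).trans (sum_abs_basisFun_le hab hM hx)

/-! ### Cancellation and telescoping of the moments over the mesh. -/

/-- If `ξ` sits `i ≤ M` half steps to the right of `p`, then the moments of the elements
`l` and `i - 1 - l` cancel and the remaining ones telescope. -/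
lemma abs_sum_bubbleMoment_le_of_le {γ : ℝ} (hγ0 : 0 < γ) (hγ : γ < 1) {p h ξ : ℝ} {i M : ℕ}
    (hh : 0 < h) (hi : 1 ≤ i) (hiM : i ≤ M) (hξ : ξ = p + i / 2 * h) :
    |∑ l ∈ Finset.range M, bubbleMoment γ ξ h (p + l * h)| ≤ h ^ 4 * (ξ - p) ^ (-γ) := by
  obtain ⟨n, rfl⟩ := Nat.exists_eq_add_of_le hiM
  have hi' : (1 : ℝ) ≤ i := by exact_mod_cast hi
  have zero : ∑ l ∈ Finset.range i, bubbleMoment γ ξ h (p + l * h) = 0 := by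
    have e := Finset.sum_range_reflect (fun l : ℕ => bubbleMoment γ ξ h (p + l * h)) i
    have e' : ∑ j ∈ Finset.range i, bubbleMoment γ ξ h (p + ((i - 1 - j : ℕ) : ℝ) * h) =
        ∑ j ∈ Finset.range i, -bubbleMoment γ ξ h (p + j * h) := by
      refine Finset.sum_congr rfl fun j hj => ?_
      rw [Finset.mem_range] at hj
      rw [← bubbleMoment_reflect, Nat.cast_sub (by omega), Nat.cast_sub hi, hξ]
      congr 1
      push_cast
      ring
    rw [e', Finset.sum_neg_distrib] at e
    linarith
  rw [Finset.sum_range_add, zero, zero_add]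
  have bound : ∀ x ∈ Finset.range n, |bubbleMoment γ ξ h (p + ((i + x : ℕ) : ℝ) * h)| ≤
      h ^ 4 * weight γ ξ (p + (i + (x : ℕ)) * h) -
        h ^ 4 * weight γ ξ (p + (i + ((x + 1 : ℕ) : ℝ)) * h) := by
    intro x _
    have hx : (0 : ℝ) ≤ x := by positivity
    have hp : ξ < p + ((i + x : ℕ) : ℝ) * h := by
      rw [hξ]; push_cast
      nlinarith
    refine (abs_bubbleMoment_le_sub hγ0 hγ hh.le hp).trans_eq ?_
    rw [mul_sub]
    push_cast
    congr 3
    ring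
  refine (Finset.abs_sum_le_sum_abs _ _).trans ((Finset.sum_le_sum bound).trans ?_)
  rw [Finset.sum_range_sub' (fun x : ℕ => h ^ 4 * weight γ ξ (p + (i + x) * h))]
  have w0 : 0 ≤ h ^ 4 * weight γ ξ (p + (i + n) * h) :=
    mul_nonneg (by positivity) (weight_nonneg _ _ _)
  -- The first uncancelled element starts at the mirror image of `p` in `ξ`.
  have e : weight γ ξ (p + (i + (0 : ℕ)) * h) = (ξ - p) ^ (-γ) := by
    unfold weight
    rw [hξ]
    push_cast
    rw [show p + i / 2 * h - (p + (i + 0) * h) = -(i / 2 * h) by ring, abs_neg,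
      abs_of_pos (by positivity), add_sub_cancel_left]
  rw [← e]
  linarith

lemma eta_pos {a b : ℝ} {M i : ℕ} (hab : a < b) (hM : 1 ≤ M) (hi : 1 ≤ i) (hiM : i < 2 * M) :
    0 < eta a b M i := by
  have h := step_pos hab hM
  have e := mul_step (a := a) (b := b) hM
  have h1 : (1 : ℝ) ≤ i := by exact_mod_cast hi
  have h2 : (i : ℝ) + 1 ≤ 2 * M := by exact_mod_cast hiM
  unfold eta node
  refine lt_min ?_ ?_ <;> nlinarith

lemma abs_sum_bubbleMoment_le {γ : ℝ} (hγ0 : 0 < γ) (hγ : γ < 1) {a b : ℝ} {M i : ℕ}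
    (hab : a < b) (hM : 1 ≤ M) (hi : 1 ≤ i) (hiM : i < 2 * M) :
    |∑ l ∈ Finset.range M, bubbleMoment γ (node a b M i) (step a b M) (a + l * step a b M)| ≤
      step a b M ^ 4 * eta a b M i ^ (-γ) := by
  have h := step_pos hab hM
  have e := mul_step (a := a) (b := b) hM
  have η0 := eta_pos hab hM hi hiM
  rcases Nat.le_total i M with hle | hle
  · refine (abs_sum_bubbleMoment_le_of_le hγ0 hγ h hi hle (by rw [node])).trans ?_
    gcongr ?_ * ?_
    exact Real.rpow_le_rpow_of_nonpos η0 (min_le_left _ _) (by linarith)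
  · set ξ := node a b M i with hξ
    -- Reflection about `ξ` turns the endpoint `b` into the left end `2 * ξ - b`, with `ξ` lying `2
    -- * M - i` half steps from it.
    have flip : ∑ l ∈ Finset.range M, bubbleMoment γ ξ (step a b M) (a + l * step a b M) =
        -∑ l ∈ Finset.range M,
          bubbleMoment γ ξ (step a b M) (2 * ξ - b + l * step a b M) := by
      rw [← Finset.sum_range_reflect, ← Finset.sum_neg_distrib]
      refine Finset.sum_congr rfl fun j hj => ?_
      rw [Finset.mem_range] at hj
      rw [← bubbleMoment_reflect, Nat.cast_sub (by omega), Nat.cast_sub hM]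
      congr 1
      push_cast
      linarith
    rw [flip, abs_neg]
    refine (abs_sum_bubbleMoment_le_of_le hγ0 hγ h (i := 2 * M - i) (by omega) (by omega)
      ?_).trans ?_
    · rw [Nat.cast_sub (by omega), hξ, node]
      push_cast
      linarith
    · gcongr ?_ * ?_
      exact Real.rpow_le_rpow_of_nonpos η0 ((min_le_right _ _).trans_eq (by rw [hξ]; ring))
        (by linarith)

lemma one_le_mul_eta_rpow {γ : ℝ} (hγ0 : 0 < γ) {a b : ℝ} {M i : ℕ}
    (hab : a < b) (hM : 1 ≤ M) (hi : 1 ≤ i) (hiM : i < 2 * M) :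
    1 ≤ (b - a) ^ γ * eta a b M i ^ (-γ) := by
  have η0 := eta_pos hab hM hi hiM
  have hle : eta a b M i ≤ b - a :=
    (min_le_left _ _).trans (by linarith [(node_mem_Icc hab hM hiM.le).2])
  rw [Real.rpow_neg η0.le, ← div_eq_mul_inv, one_le_div (Real.rpow_pos_of_pos η0 _)]
  exact Real.rpow_le_rpow η0.le hle hγ0.le

/-! ### Taylor expansion and the local interpolation error. -/

lemma abs_le_of_abs_deriv_le {a b m K : ℝ} {n : ℕ} {f f' : ℝ → ℝ} (hK : 0 ≤ K)
    (hm : m ∈ Icc a b) (hf : ∀ x ∈ Icc a b, HasDerivWithinAt f (f' x) (Icc a b) x)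
    (hfm : f m = 0) (hf' : ∀ x ∈ Icc a b, |f' x| ≤ K * |x - m| ^ n) :
    ∀ x ∈ Icc a b, |f x| ≤ K * |x - m| ^ (n + 1) := by
  intro x hx
  have sub : uIcc m x ⊆ Icc a b := uIcc_subset_Icc hm hx
  have := (convex_uIcc m x).norm_image_sub_le_of_norm_hasDerivWithin_le (f := f) (f' := f')
    (C := K * |x - m| ^ n) (fun y hy => (hf y (sub hy)).mono sub)
    (fun y hy => (hf' y (sub hy)).trans (by
      gcongr K * ?_ ^ n
      exact abs_sub_left_of_mem_uIcc hy)) left_mem_uIcc right_mem_uIcc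
  rw [hfm, sub_zero, Real.norm_eq_abs, Real.norm_eq_abs] at this
  rw [pow_succ, ← mul_assoc]
  exact this

/-- `g` is three times differentiable on `[a, b]`, and its third derivative is bounded by `K` and
`K`-Lipschitz. -/
structure ThirdDerivControl (a b K : ℝ) (g g₁ g₂ g₃ : ℝ → ℝ) : Prop where
  deriv₁ : ∀ x ∈ Icc a b, HasDerivWithinAt g (g₁ x) (Icc a b) x
  deriv₂ : ∀ x ∈ Icc a b, HasDerivWithinAt g₁ (g₂ x) (Icc a b) x
  deriv₃ : ∀ x ∈ Icc a b, HasDerivWithinAt g₂ (g₃ x) (Icc a b) x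
  bound : ∀ x ∈ Icc a b, |g₃ x| ≤ K
  lipschitz : ∀ x ∈ Icc a b, ∀ y ∈ Icc a b, |g₃ x - g₃ y| ≤ K * |x - y|

lemma ThirdDerivControl.abs_taylor_le {a b K : ℝ} {g g₁ g₂ g₃ : ℝ → ℝ}
    (H : ThirdDerivControl a b K g g₁ g₂ g₃) {m : ℝ} (hm : m ∈ Icc a b) :
    ∀ x ∈ Icc a b, |g x - (g m + g₁ m * (x - m) + g₂ m / 2 * (x - m) ^ 2 +
      g₃ m / 6 * (x - m) ^ 3)| ≤ K * |x - m| ^ 4 := by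
  have hK : 0 ≤ K := (abs_nonneg _).trans (H.bound m hm)
  have hid : ∀ x, HasDerivWithinAt (fun x : ℝ => x - m) 1 (Icc a b) x := fun x =>
    (hasDerivWithinAt_id x _).sub_const m
  have s2 : ∀ x ∈ Icc a b, |g₂ x - (g₂ m + g₃ m * (x - m))| ≤ K * |x - m| ^ (1 + 1) := by
    refine abs_le_of_abs_deriv_le (f' := fun x => g₃ x - g₃ m) hK hm (fun x hx => ?_) (by simp)
      (fun x hx => by simpa using H.lipschitz x hx m hm)
    exact ((H.deriv₃ x hx).sub (((hid x).const_mul (g₃ m)).const_add (g₂ m))).congr_deriv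
      (by ring)
  have s1 : ∀ x ∈ Icc a b, |g₁ x - (g₁ m + g₂ m * (x - m) + g₃ m / 2 * (x - m) ^ 2)| ≤
      K * |x - m| ^ (1 + 1 + 1) := by
    refine abs_le_of_abs_deriv_le (f' := fun x => g₂ x - (g₂ m + g₃ m * (x - m)))
      hK hm (fun x hx => ?_) (by simp) s2
    exact ((H.deriv₂ x hx).sub ((((hid x).const_mul (g₂ m)).const_add (g₁ m)).add
      (((hid x).pow 2).const_mul (g₃ m / 2)))).congr_deriv (by push_cast; ring)
  refine abs_le_of_abs_deriv_le (n := 3)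
      (f' := fun x => g₁ x - (g₁ m + g₂ m * (x - m) + g₃ m / 2 * (x - m) ^ 2))
      hK hm (fun x hx => ?_) (by simp) s1
  exact ((H.deriv₁ x hx).sub (((((hid x).const_mul (g₁ m)).const_add (g m)).add
      (((hid x).pow 2).const_mul (g₂ m / 2))).add
      (((hid x).pow 3).const_mul (g₃ m / 6)))).congr_deriv (by push_cast; ring)

/-- The piecewise quadratic Lagrange interpolant in one variable. -/
noncomputable def interp₁ (a b : ℝ) (M : ℕ) (g : ℝ → ℝ) (x : ℝ) : ℝ :=
  ∑ k ∈ Finset.range (2 * M + 1), basisFun a b M k x * g (node a b M k)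

/-- Quadratics are reproduced and the error of the monic cubic is the bubble, so the cubic Taylor
polynomial at the midpoint produces exactly the subtracted term. The remainder, at most `K * h ^ 4`,
enters once directly and at most three times through the interpolant. -/
lemma ThirdDerivControl.abs_sub_interp₁_sub_bubble_le {a b K : ℝ} {g g₁ g₂ g₃ : ℝ → ℝ}
    (H : ThirdDerivControl a b K g g₁ g₂ g₃) {M l : ℕ} (hab : a < b) (hM : 1 ≤ M) (hl : l < M)
    {x : ℝ} (hx : x ∈ Icc (a + l * step a b M) (a + l * step a b M + step a b M)) :
    |g x - interp₁ a b M g x - g₃ (a + l * step a b M + step a b M / 2) / 6 *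
      bubble (a + l * step a b M) (step a b M) x| ≤ 4 * K * step a b M ^ 4 := by
  have h0 := step_pos hab hM
  have e := mul_step (a := a) (b := b) hM
  have hl1 : (l : ℝ) + 1 ≤ M := by exact_mod_cast hl
  have hl0 : (0 : ℝ) ≤ l := by positivity
  set h := step a b M with hh
  set p := a + l * h with hp
  have sub : Icc p (p + h) ⊆ Icc a b := Icc_subset_Icc (by nlinarith) (by nlinarith)
  set m := p + h / 2 with hm
  have mI : m ∈ Icc p (p + h) := ⟨by linarith, by linarith⟩
  have hK : 0 ≤ K := (abs_nonneg _).trans (H.bound m (sub mI))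
  set T : ℝ → ℝ := fun x => g m + g₁ m * (x - m) + g₂ m / 2 * (x - m) ^ 2 +
      g₃ m / 6 * (x - m) ^ 3 with hT
  have R : ∀ y ∈ Icc p (p + h), |g y - T y| ≤ K * h ^ 4 := by
    intro y hy
    refine (H.abs_taylor_le (sub mI) y (sub hy)).trans ?_
    gcongr
    exact abs_le.mpr ⟨by linarith [hy.1], by linarith [hy.2]⟩
  obtain ⟨t, ht, rfl⟩ : ∃ t ∈ Icc (0 : ℝ) 1, x = p + t * h :=
    ⟨(x - p) / h, ⟨div_nonneg (by linarith [hx.1]) h0.le,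
      (div_le_one h0).mpr (by linarith [hx.2])⟩, by field_simp; ring⟩
  have n0 : node a b M (2 * l) = p := node_two_mul a b M l
  have n1 : node a b M (2 * l + 1) = m := by rw [node, hm, hp, hh]; push_cast; ring
  have n2 : node a b M (2 * l + 2) = p + h := by rw [node, hp, hh]; push_cast; ring
  have eI : interp₁ a b M g (p + t * h) = (1 - t) * (1 - 2 * t) * g p + 4 * t * (1 - t) * g m +
      t * (2 * t - 1) * g (p + h) := by
    rw [interp₁, hp, hh, sum_basisFun_mul h0 hl ht (fun k => g (node a b M k)), n0, n1, n2]
  have split : g (p + t * h) - interp₁ a b M g (p + t * h) - g₃ m / 6 * bubble p h (p + t * h) =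
      (g (p + t * h) - T (p + t * h)) - ((1 - t) * (1 - 2 * t) * (g p - T p) +
        4 * t * (1 - t) * (g m - T m) + t * (2 * t - 1) * (g (p + h) - T (p + h))) := by
    rw [eI, hT, bubble]
    dsimp only
    rw [hm]
    ring
  rw [split]
  have comb := abs_quadratic_shape_combination_le ht (R p ⟨le_rfl, by linarith⟩) (R m mI)
    (R (p + h) ⟨by linarith, le_rfl⟩)
  have r := R _ hx
  exact (abs_sub _ _).trans (by linarith)

/-! ### The weighted error in one variable. -/

lemma basisFun_mul_weight_intervalIntegrable {γ : ℝ} (hγ : γ < 1) {a b : ℝ} {M k : ℕ}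
    (hab : a < b) (hM : 1 ≤ M) (hk : k ≤ 2 * M) (ξ : ℝ) :
    IntervalIntegrable (fun x => basisFun a b M k x * weight γ ξ x) volume a b := by
  have hw := weight_intervalIntegrable hγ ξ a b
  rw [intervalIntegrable_iff_integrableOn_Ioc_of_le hab.le] at hw ⊢
  refine Integrable.bdd_mul (c := 3) hw (measurable_basisFun a b M k).aestronglyMeasurable ?_
  filter_upwards [ae_restrict_mem measurableSet_Ioc] with x hx
  exact abs_basisFun_le hab hM hk ⟨hx.1.le, hx.2⟩

lemma sub_interp₁_mul_weight_intervalIntegrable {γ : ℝ} (hγ : γ < 1) {a b : ℝ} {M : ℕ}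
    (hab : a < b) (hM : 1 ≤ M) (ξ : ℝ) {g : ℝ → ℝ} (hg : ContinuousOn g (Icc a b)) :
    IntervalIntegrable (fun x => (g x - interp₁ a b M g x) * weight γ ξ x) volume a b := by
  have h1 : IntervalIntegrable (fun x => g x * weight γ ξ x) volume a b :=
    (weight_intervalIntegrable hγ ξ a b).continuousOn_mul (by rwa [uIcc_of_le hab.le])
  have h2 : IntervalIntegrable (fun x => ∑ k ∈ Finset.range (2 * M + 1),
      g (node a b M k) * (basisFun a b M k x * weight γ ξ x)) volume a b := by
    have := IntervalIntegrable.sum (μ := volume) (a := a) (b := b) (Finset.range (2 * M + 1))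
      (f := fun k x => g (node a b M k) * (basisFun a b M k x * weight γ ξ x)) fun k hk =>
      (basisFun_mul_weight_intervalIntegrable hγ hab hM
        (by rw [Finset.mem_range] at hk; omega) ξ).const_mul (g (node a b M k))
    simpa only [Finset.sum_fn] using this
  refine (h1.sub h2).congr fun x _ => ?_
  simp only [interp₁, sub_mul, Finset.sum_mul]
  congr 1
  exact Finset.sum_congr rfl fun k _ => by ring

lemma ThirdDerivControl.abs_integral_element_le {γ : ℝ} (hγ0 : 0 < γ) (hγ : γ < 1)
    {a b K : ℝ} {g g₁ g₂ g₃ : ℝ → ℝ} (H : ThirdDerivControl a b K g g₁ g₂ g₃) {M i l : ℕ}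
    (hab : a < b) (hM : 1 ≤ M) (hiM : i ≤ 2 * M) (hl : l < M)
    (hint : IntervalIntegrable
      (fun x => (g x - interp₁ a b M g x) * weight γ (node a b M i) x) volume
      (a + l * step a b M) (a + l * step a b M + step a b M)) :
    |(∫ x in (a + l * step a b M)..(a + l * step a b M + step a b M),
        (g x - interp₁ a b M g x) * weight γ (node a b M i) x) -
      g₃ (node a b M i) / 6 *
        bubbleMoment γ (node a b M i) (step a b M) (a + l * step a b M)| ≤
    5 * K * step a b M ^ 4 * ∫ x in (a + l * step a b M)..(a + l * step a b M + step a b M),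
      weight γ (node a b M i) x := by
  have h0 := step_pos hab hM
  have e := mul_step (a := a) (b := b) hM
  have hl1 : (l : ℝ) + 1 ≤ M := by exact_mod_cast hl
  have hl0 : (0 : ℝ) ≤ l := by positivity
  have hξ := node_mem_Icc hab hM hiM
  have local_bound := fun x hx =>
    H.abs_sub_interp₁_sub_bubble_le (x := x) hab hM hl hx
  -- Nodes are spaced by half steps, so one outside the closed element is at least `h / 2` away.
  have position : node a b M i ∈ Icc (a + l * step a b M) (a + l * step a b M + step a b M) ∨
      step a b M / 2 ≤ a + l * step a b M - node a b M i ∨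
      step a b M / 2 ≤ node a b M i - (a + l * step a b M + step a b M) := by
    unfold node
    rcases Nat.lt_or_ge i (2 * l) with h | h
    · right; left
      have : (i : ℝ) + 1 ≤ 2 * l := by exact_mod_cast h
      nlinarith
    · have h' : 2 * (l : ℝ) ≤ i := by exact_mod_cast h
      rcases Nat.lt_or_ge (2 * l + 2) i with h2 | h2
      · right; right
        have : 2 * (l : ℝ) + 2 + 1 ≤ i := by exact_mod_cast h2
        nlinarith
      · left
        have : (i : ℝ) ≤ 2 * l + 2 := by exact_mod_cast h2
        constructor <;> nlinarith
  set h := step a b M with hh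
  set p := a + l * h with hp
  set ξ := node a b M i
  have mI : p + h / 2 ∈ Icc a b := ⟨by nlinarith, by nlinarith⟩
  have hK : 0 ≤ K := (abs_nonneg _).trans (H.bound ξ hξ)
  have moment := abs_sub_mul_bubbleMoment_le hγ0 hγ h0 position
  have lip := H.lipschitz _ mI _ hξ
  have W0 := integral_weight_nonneg (γ := γ) (ξ := ξ) (by linarith : p ≤ p + h)
  have first : |(∫ x in p..p + h, (g x - interp₁ a b M g x) * weight γ ξ x) -
      g₃ (p + h / 2) / 6 * bubbleMoment γ ξ h p| ≤
      4 * K * h ^ 4 * ∫ x in p..p + h, weight γ ξ x := by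
    rw [bubbleMoment, ← intervalIntegral.integral_const_mul,
      ← intervalIntegral.integral_sub hint
        ((bubble_mul_weight_intervalIntegrable hγ _ _ _ _ _).const_mul _),
      ← intervalIntegral.integral_const_mul, ← Real.norm_eq_abs]
    refine intervalIntegral.norm_integral_le_of_norm_le (by linarith)
      (Filter.Eventually.of_forall fun x hx => ?_)
      ((weight_intervalIntegrable hγ ξ _ _).const_mul _)
    rw [← mul_assoc, ← sub_mul, Real.norm_eq_abs, abs_mul, abs_of_nonneg (weight_nonneg _ _ _)]
    exact mul_le_mul_of_nonneg_right (local_bound x ⟨hx.1.le, hx.2⟩) (weight_nonneg _ _ _)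
  have second : |(g₃ (p + h / 2) - g₃ ξ) / 6 * bubbleMoment γ ξ h p| ≤
      K * h ^ 4 * ∫ x in p..p + h, weight γ ξ x := by
    rw [abs_mul, abs_div, abs_of_pos (by norm_num : (0 : ℝ) < 6)]
    calc _ ≤ K * |p + h / 2 - ξ| / 6 * |bubbleMoment γ ξ h p| := by gcongr
      _ = K / 6 * (|p + h / 2 - ξ| * |bubbleMoment γ ξ h p|) := by ring
      _ ≤ K / 6 * (3 * h ^ 4 * ∫ x in p..p + h, weight γ ξ x) := by gcongr
      _ = 1 / 2 * (K * h ^ 4 * ∫ x in p..p + h, weight γ ξ x) := by ring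
      _ ≤ 1 * (K * h ^ 4 * ∫ x in p..p + h, weight γ ξ x) := by
        gcongr; norm_num
      _ = _ := one_mul _
  have tri := abs_add_le ((∫ x in p..p + h, (g x - interp₁ a b M g x) * weight γ ξ x) -
      g₃ (p + h / 2) / 6 * bubbleMoment γ ξ h p)
      ((g₃ (p + h / 2) - g₃ ξ) / 6 * bubbleMoment γ ξ h p)
  rw [show ∀ A J t s : ℝ, A - t / 6 * J + (t - s) / 6 * J = A - s / 6 * J by
    intros; ring] at tri
  linarith

/-- The weighted quadratic interpolation error in one variable, uniformly in the function, the
mesh and the position of the singularity. -/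
theorem exists_abs_integral_sub_interp₁_le {γ : ℝ} (hγ0 : 0 < γ) (hγ : γ < 1) {a b : ℝ}
    (hab : a < b) :
    ∃ C : ℝ, 0 ≤ C ∧ ∀ (K : ℝ) (g g₁ g₂ g₃ : ℝ → ℝ), ThirdDerivControl a b K g g₁ g₂ g₃ →
      ∀ M i : ℕ, 1 ≤ M → 1 ≤ i → i < 2 * M →
        |∫ x in a..b, (g x - interp₁ a b M g x) * weight γ (node a b M i) x| ≤
          C * K * (step a b M ^ 4 * eta a b M i ^ (-γ)) := by
  set W := ∫ s in (-(b - a))..(b - a), |s| ^ (-γ) with hW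
  have W0 : 0 ≤ W := intervalIntegral.integral_nonneg (by linarith) fun s _ =>
    Real.rpow_nonneg (abs_nonneg _) _
  have L0 : 0 ≤ (b - a) ^ γ := Real.rpow_nonneg (by linarith) _
  -- The first summand absorbs the element remainders into `η ^ (-γ)`; the 1 pays for the moment
  -- sum.
  refine ⟨5 * W * (b - a) ^ γ + 1, by positivity, ?_⟩
  intro K g g₁ g₂ g₃ H M i hM hi hiM
  have h0 := step_pos hab hM
  have e := mul_step (a := a) (b := b) hM
  have hξ := node_mem_Icc hab hM hiM.le
  have hsum := abs_sum_bubbleMoment_le hγ0 hγ hab hM hi hiM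
  have hη := one_le_mul_eta_rpow hγ0 hab hM hi hiM
  have η0 : 0 ≤ eta a b M i ^ (-γ) := Real.rpow_nonneg (eta_pos hab hM hi hiM).le _
  have gc : ContinuousOn g (Icc a b) := fun x hx => (H.deriv₁ x hx).continuousWithinAt
  have hint := sub_interp₁_mul_weight_intervalIntegrable hγ hab hM (node a b M i) gc
  have elem := fun l (hl : l < M) hi => H.abs_integral_element_le hγ0 hγ hab hM hiM.le hl hi
  set h := step a b M
  set ξ := node a b M i
  have hK : 0 ≤ K := (abs_nonneg _).trans (H.bound ξ hξ)
  have hW' := integral_weight_le hγ hξ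
  set E := fun x => (g x - interp₁ a b M g x) * weight γ ξ x with hE
  have nodes : ∀ l : ℕ, a + ((l + 1 : ℕ) : ℝ) * h = a + l * h + h := by
    intro l; push_cast; ring
  have endpoints : a + ((0 : ℕ) : ℝ) * h = a ∧ a + (M : ℝ) * h = b :=
    ⟨by simp, by linarith⟩
  have hint' : ∀ l < M, IntervalIntegrable E volume (a + l * h) (a + l * h + h) := by
    intro l hl
    have hl1 : (l : ℝ) + 1 ≤ M := by exact_mod_cast hl
    have hl0 : (0 : ℝ) ≤ l := by positivity
    refine hint.mono_set ?_
    rw [uIcc_of_le (by linarith), uIcc_of_le hab.le]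
    exact Icc_subset_Icc (by nlinarith) (by nlinarith)
  have sumE : ∫ x in a..b, E x =
      ∑ l ∈ Finset.range M, ∫ x in (a + l * h)..(a + l * h + h), E x := by
    have := intervalIntegral.sum_integral_adjacent_intervals (f := E) (μ := volume)
      (a := fun l : ℕ => a + l * h) (n := M) (fun l hl => by rw [nodes]; exact hint' l hl)
    simp only [nodes, endpoints.1, endpoints.2] at this
    exact this.symm
  have sumW : ∫ x in a..b, weight γ ξ x =
      ∑ l ∈ Finset.range M, ∫ x in (a + l * h)..(a + l * h + h), weight γ ξ x := by
    have := intervalIntegral.sum_integral_adjacent_intervals (f := weight γ ξ) (μ := volume)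
      (a := fun l : ℕ => a + l * h) (n := M) (fun l _ => weight_intervalIntegrable hγ _ _ _)
    simp only [nodes, endpoints.1, endpoints.2] at this
    exact this.symm
  have diff : |∫ x in a..b, E x| ≤ |g₃ ξ / 6 *
      ∑ l ∈ Finset.range M, bubbleMoment γ ξ h (a + l * h)| + 5 * K * h ^ 4 * W := by
    have : |(∫ x in a..b, E x) - g₃ ξ / 6 *
        ∑ l ∈ Finset.range M, bubbleMoment γ ξ h (a + l * h)| ≤ 5 * K * h ^ 4 * W := by
      rw [sumE, Finset.mul_sum, ← Finset.sum_sub_distrib]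
      refine (Finset.abs_sum_le_sum_abs _ _).trans ?_
      refine (Finset.sum_le_sum fun l hl => elem l (Finset.mem_range.mp hl)
        (hint' l (Finset.mem_range.mp hl))).trans ?_
      rw [← Finset.mul_sum, ← sumW]
      gcongr
    have t := abs_sub_abs_le_abs_sub (∫ x in a..b, E x) (g₃ ξ / 6 *
        ∑ l ∈ Finset.range M, bubbleMoment γ ξ h (a + l * h))
    linarith
  refine diff.trans ?_
  have t1 : |g₃ ξ / 6 * ∑ l ∈ Finset.range M, bubbleMoment γ ξ h (a + l * h)| ≤
      K * (h ^ 4 * eta a b M i ^ (-γ)) := by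
    rw [abs_mul]
    refine mul_le_mul ?_ hsum (abs_nonneg _) hK
    rw [abs_div, abs_of_pos (by norm_num : (0 : ℝ) < 6)]
    linarith [H.bound ξ hξ, abs_nonneg (g₃ ξ)]
  have t2 : 5 * K * h ^ 4 * W ≤ 5 * K * h ^ 4 * W * ((b - a) ^ γ * eta a b M i ^ (-γ)) :=
    le_mul_of_one_le_right (by positivity) hη
  calc _ ≤ K * (h ^ 4 * eta a b M i ^ (-γ)) +
        5 * K * h ^ 4 * W * ((b - a) ^ γ * eta a b M i ^ (-γ)) := add_le_add t1 t2
    _ = _ := by ring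

/-! ### Derivative bounds uniform in the other variable. -/

lemma exists_partial_deriv {a b c d : ℝ} (hab : a < b) (hcd : c < d) {n : ℕ} {f : ℝ × ℝ → ℝ}
    (hf : ContDiffOn ℝ (n + 1 : ℕ) f (Icc a b ×ˢ Icc c d)) :
    ∃ f' : ℝ × ℝ → ℝ, ContDiffOn ℝ n f' (Icc a b ×ˢ Icc c d) ∧
      ∀ y ∈ Icc c d, ∀ x ∈ Icc a b,
        HasDerivWithinAt (fun x => f (x, y)) (f' (x, y)) (Icc a b) x := by
  have hU : UniqueDiffOn ℝ (Icc a b ×ˢ Icc c d) :=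
    (uniqueDiffOn_Icc hab).prod (uniqueDiffOn_Icc hcd)
  refine ⟨fun p => fderivWithin ℝ f (Icc a b ×ˢ Icc c d) p (1, 0),
    (hf.fderivWithin hU (m := n) (by norm_cast)).clm_apply contDiffOn_const, ?_⟩
  intro y hy x hx
  have h1 : HasFDerivWithinAt f (fderivWithin ℝ f (Icc a b ×ˢ Icc c d) (x, y))
      (Icc a b ×ˢ Icc c d) (x, y) :=
    (hf.differentiableOn (by simp) (x, y) ⟨hx, hy⟩).hasFDerivWithinAt
  exact h1.comp_hasDerivWithinAt (f := fun x : ℝ => (x, y)) x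
    ((hasDerivWithinAt_id x _).prodMk (hasDerivWithinAt_const x _ y)) fun z hz => ⟨hz, hy⟩

lemma exists_thirdDerivControl {a b c d : ℝ} (hab : a < b) (hcd : c < d) {f : ℝ × ℝ → ℝ}
    (hf : ContDiffOn ℝ 6 f (Icc a b ×ˢ Icc c d)) :
    ∃ K : ℝ, 0 ≤ K ∧ ∀ y ∈ Icc c d, ∃ g₁ g₂ g₃ : ℝ → ℝ,
      ThirdDerivControl a b K (fun x => f (x, y)) g₁ g₂ g₃ := by
  obtain ⟨f₁, hf₁, d₁⟩ := exists_partial_deriv hab hcd (n := 3) (hf.of_le (by norm_num))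
  obtain ⟨f₂, hf₂, d₂⟩ := exists_partial_deriv hab hcd (n := 2) hf₁
  obtain ⟨f₃, hf₃, d₃⟩ := exists_partial_deriv hab hcd (n := 1) hf₂
  obtain ⟨f₄, hf₄, d₄⟩ := exists_partial_deriv hab hcd (n := 0) hf₃
  have hc : IsCompact (Icc a b ×ˢ Icc c d) := isCompact_Icc.prod isCompact_Icc
  obtain ⟨K₃, hK₃⟩ := hc.exists_bound_of_continuousOn hf₃.continuousOn
  obtain ⟨K₄, hK₄⟩ := hc.exists_bound_of_continuousOn hf₄.continuousOn
  refine ⟨max (max K₃ K₄) 0, le_max_right _ _, fun y hy =>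
    ⟨fun x => f₁ (x, y), fun x => f₂ (x, y), fun x => f₃ (x, y), d₁ y hy, d₂ y hy, d₃ y hy,
      fun x hx => (hK₃ (x, y) ⟨hx, hy⟩).trans ((le_max_left _ _).trans (le_max_left _ _)), ?_⟩⟩
  intro x hx z hz
  exact (convex_Icc a b).norm_image_sub_le_of_norm_hasDerivWithin_le (d₄ y hy)
    (fun w hw => (hK₄ (w, y) ⟨hw, hy⟩).trans ((le_max_right _ _).trans (le_max_left _ _))) hz hx

/-! ### From one variable to two. -/

lemma interp_eq_sum_interp₁ (a b c d : ℝ) (Mx My : ℕ) (u : ℝ → ℝ → ℝ) (x y : ℝ) :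
    interp a b c d Mx My u x y = ∑ l ∈ Finset.range (2 * Mx + 1),
      basisFun a b Mx l x * interp₁ c d My (u (node a b Mx l)) y := by
  simp only [interp, interp₁, Finset.mul_sum, mul_assoc]

lemma errIntegrand_eq (γ a b c d : ℝ) (u : ℝ → ℝ → ℝ) (Mx My i j : ℕ) (x y : ℝ) :
    errIntegrand γ a b c d u Mx My i j x y = (u x y - interp a b c d Mx My u x y) *
      (weight γ (node a b Mx i) x * weight γ (node c d My j) y) := by
  rw [errIntegrand, weight, weight, Real.rpow_neg (abs_nonneg _), Real.rpow_neg (abs_nonneg _),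
    div_eq_mul_inv, mul_inv]

/-- Splitting of the biquadratic interpolation error into errors in one variable. -/
lemma errIntegrand_eq_add (γ a b c d : ℝ) (u : ℝ → ℝ → ℝ) (Mx My i j : ℕ) (x y : ℝ) :
    errIntegrand γ a b c d u Mx My i j x y =
      weight γ (node c d My j) y *
        ((u x y - interp₁ a b Mx (fun x => u x y) x) * weight γ (node a b Mx i) x) +
      ∑ l ∈ Finset.range (2 * Mx + 1),
        (u (node a b Mx l) y - interp₁ c d My (u (node a b Mx l)) y) *
          weight γ (node c d My j) y * (basisFun a b Mx l x * weight γ (node a b Mx i) x) := by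
  have : ∑ l ∈ Finset.range (2 * Mx + 1),
        (u (node a b Mx l) y - interp₁ c d My (u (node a b Mx l)) y) *
          weight γ (node c d My j) y * (basisFun a b Mx l x * weight γ (node a b Mx i) x) =
      (interp₁ a b Mx (fun x => u x y) x - interp a b c d Mx My u x y) *
      (weight γ (node a b Mx i) x * weight γ (node c d My j) y) := by
    rw [interp_eq_sum_interp₁, interp₁, ← Finset.sum_sub_distrib, Finset.sum_mul]
    exact Finset.sum_congr rfl fun l _ => by ring
  rw [this, errIntegrand_eq]
  ring

lemma integrable_errIntegrand {γ : ℝ} (hγ : γ < 1) {a b c d : ℝ} (hab : a < b) (hcd : c < d)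
    {u : ℝ → ℝ → ℝ} (hu : ContinuousOn (fun p : ℝ × ℝ => u p.1 p.2) (Icc a b ×ˢ Icc c d))
    {Mx My : ℕ} (hMx : 1 ≤ Mx) (hMy : 1 ≤ My) (i j : ℕ) :
    Integrable (fun p : ℝ × ℝ => errIntegrand γ a b c d u Mx My i j p.1 p.2)
      ((volume.restrict (Icc a b)).prod (volume.restrict (Icc c d))) := by
  have hc : IsCompact (Icc a b ×ˢ Icc c d) := isCompact_Icc.prod isCompact_Icc
  obtain ⟨B, hB⟩ := hc.exists_bound_of_continuousOn hu
  have toIcc : ∀ {p q : ℝ} {f : ℝ → ℝ}, p < q → IntervalIntegrable f volume p q →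
      Integrable f (volume.restrict (Icc p q)) := fun h hf =>
    (intervalIntegrable_iff_integrableOn_Icc_of_le h.le).mp hf
  have h1 : Integrable (fun p : ℝ × ℝ => u p.1 p.2 *
      (weight γ (node a b Mx i) p.1 * weight γ (node c d My j) p.2))
      ((volume.restrict (Icc a b)).prod (volume.restrict (Icc c d))) := by
    refine Integrable.bdd_mul (c := B)
      ((toIcc hab (weight_intervalIntegrable hγ _ _ _)).mul_prod
        (toIcc hcd (weight_intervalIntegrable hγ _ _ _))) ?_ ?_
    · rw [Measure.prod_restrict]
      exact hu.aestronglyMeasurable (measurableSet_Icc.prod measurableSet_Icc)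
    · rw [Measure.prod_restrict]
      filter_upwards [ae_restrict_mem (measurableSet_Icc.prod measurableSet_Icc)] with p hp
      exact hB p hp
  have h2 : Integrable (fun p : ℝ × ℝ => ∑ l ∈ Finset.range (2 * Mx + 1),
      ∑ r ∈ Finset.range (2 * My + 1), u (node a b Mx l) (node c d My r) *
        ((basisFun a b Mx l p.1 * weight γ (node a b Mx i) p.1) *
          (basisFun c d My r p.2 * weight γ (node c d My j) p.2)))
      ((volume.restrict (Icc a b)).prod (volume.restrict (Icc c d))) := by
    refine integrable_finsetSum _ fun l hl => integrable_finsetSum _ fun r hr => ?_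
    rw [Finset.mem_range] at hl hr
    exact ((toIcc hab (basisFun_mul_weight_intervalIntegrable hγ hab hMx (by omega) _)).mul_prod
      (toIcc hcd (basisFun_mul_weight_intervalIntegrable hγ hcd hMy (by omega) _))).const_mul _
  refine (h1.sub h2).congr (Filter.Eventually.of_forall fun p => ?_)
  simp only [Pi.sub_apply, errIntegrand_eq, sub_mul, interp, Finset.sum_mul]
  congr 1
  exact Finset.sum_congr rfl fun l _ => Finset.sum_congr rfl fun r _ => by ring

/-- Summing under the integral uses the Lebesgue bound pointwise, so the estimate does not grow with
`M`. -/
lemma sum_abs_integral_basisFun_le {γ : ℝ} (hγ : γ < 1) {a b : ℝ} {M : ℕ} (hab : a < b)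
    (hM : 1 ≤ M) (ξ : ℝ) :
    ∑ l ∈ Finset.range (2 * M + 1), |∫ x in a..b, basisFun a b M l x * weight γ ξ x| ≤
      3 * ∫ x in a..b, weight γ ξ x := by
  have hint : ∀ l ∈ Finset.range (2 * M + 1),
      IntervalIntegrable (fun x => |basisFun a b M l x * weight γ ξ x|) volume a b := by
    intro l hl
    rw [Finset.mem_range] at hl
    exact (basisFun_mul_weight_intervalIntegrable hγ hab hM (by omega) ξ).abs
  refine (Finset.sum_le_sum fun l _ =>
    intervalIntegral.abs_integral_le_integral_abs hab.le).trans ?_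
  rw [← intervalIntegral.integral_finsetSum hint, ← intervalIntegral.integral_const_mul]
  have hsum := IntervalIntegrable.sum (μ := volume) (a := a) (b := b) _ hint
  simp only [Finset.sum_fn] at hsum
  refine intervalIntegral.integral_mono_on hab.le hsum
    ((weight_intervalIntegrable hγ ξ a b).const_mul 3) fun x hx => ?_
  simp only [abs_mul, abs_of_nonneg (weight_nonneg γ ξ x), ← Finset.sum_mul]
  exact mul_le_mul_of_nonneg_right (sum_abs_basisFun_le hab hM hx) (weight_nonneg _ _ _)

/-- Weighted error bounds in each variable give one for the biquadratic interpolant. -/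
lemma abs_integral_errIntegrand_le {γ : ℝ} (hγ : γ < 1) {a b c d : ℝ} (hab : a < b)
    (hcd : c < d) {u : ℝ → ℝ → ℝ}
    (hu : ContinuousOn (fun p : ℝ × ℝ => u p.1 p.2) (Icc a b ×ˢ Icc c d))
    {Mx My : ℕ} (hMx : 1 ≤ Mx) (hMy : 1 ≤ My) {i j : ℕ} {Bx By : ℝ}
    (hBx : ∀ y ∈ Icc c d, |∫ x in a..b, (u x y - interp₁ a b Mx (fun x => u x y) x) *
      weight γ (node a b Mx i) x| ≤ Bx)
    (hBy : ∀ x ∈ Icc a b, |∫ y in c..d, (u x y - interp₁ c d My (u x) y) *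
      weight γ (node c d My j) y| ≤ By) :
    |∫ y in c..d, ∫ x in a..b, errIntegrand γ a b c d u Mx My i j x y| ≤
      Bx * (∫ y in c..d, weight γ (node c d My j) y) +
        3 * (∫ x in a..b, weight γ (node a b Mx i) x) * By := by
  set ξ := node a b Mx i
  set ζ := node c d My j
  have hux : ∀ y ∈ Icc c d, ContinuousOn (fun x => u x y) (Icc a b) := fun y hy =>
    hu.comp (f := fun x => (x, y)) (by fun_prop) fun x hx => ⟨hx, hy⟩
  have huy : ∀ x ∈ Icc a b, ContinuousOn (u x) (Icc c d) := fun x hx =>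
    hu.comp (f := fun y => (x, y)) (by fun_prop) fun y hy => ⟨hx, hy⟩
  have hnode : ∀ l ∈ Finset.range (2 * Mx + 1), node a b Mx l ∈ Icc a b := fun l hl =>
    node_mem_Icc hab hMx (by rw [Finset.mem_range] at hl; omega)
  have hφ : ∀ l ∈ Finset.range (2 * Mx + 1),
      IntervalIntegrable (fun x => basisFun a b Mx l x * weight γ ξ x) volume a b := fun l hl =>
    basisFun_mul_weight_intervalIntegrable hγ hab hMx
      (by rw [Finset.mem_range] at hl; omega) ξ
  set P : ℝ → ℝ := fun y => ∫ x in a..b, errIntegrand γ a b c d u Mx My i j x y with hP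
  set e : ℕ → ℝ → ℝ := fun l y =>
    (u (node a b Mx l) y - interp₁ c d My (u (node a b Mx l)) y) * weight γ ζ y with he
  -- `Q` carries the `x`-interpolant of the error in `y`; `P - Q` carries the error in `x`.
  set Q : ℝ → ℝ := fun y => ∑ l ∈ Finset.range (2 * Mx + 1),
    e l y * ∫ x in a..b, basisFun a b Mx l x * weight γ ξ x with hQ
  have hPint : IntervalIntegrable P volume c d := by
    rw [intervalIntegrable_iff_integrableOn_Icc_of_le hcd.le]
    have := (integrable_errIntegrand hγ hab hcd hu hMx hMy i j).integral_prod_right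
    simp only [hP, intervalIntegral.integral_of_le hab.le, ← integral_Icc_eq_integral_Ioc]
    exact this
  have heint : ∀ l ∈ Finset.range (2 * Mx + 1), IntervalIntegrable (e l) volume c d :=
    fun l hl => sub_interp₁_mul_weight_intervalIntegrable hγ hcd hMy ζ (huy _ (hnode l hl))
  have hQint : IntervalIntegrable Q volume c d := by
    have := IntervalIntegrable.sum (μ := volume) (a := c) (b := d) _ fun l hl =>
      (heint l hl).mul_const (∫ x in a..b, basisFun a b Mx l x * weight γ ξ x)
    simpa only [Finset.sum_fn] using this
  have hPQ : ∀ y ∈ Icc c d, P y - Q y = weight γ ζ y *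
      ∫ x in a..b, (u x y - interp₁ a b Mx (fun x => u x y) x) * weight γ ξ x := by
    intro y hy
    have hE := (sub_interp₁_mul_weight_intervalIntegrable hγ hab hMx ξ (hux y hy)).const_mul
      (weight γ ζ y)
    have hφ' := fun l hl => (hφ l hl).const_mul (e l y)
    have hS := IntervalIntegrable.sum (μ := volume) (a := a) (b := b) _ hφ'
    simp only [Finset.sum_fn] at hS
    have : P y = (weight γ ζ y *
        ∫ x in a..b, (u x y - interp₁ a b Mx (fun x => u x y) x) * weight γ ξ x) + Q y := by
      simp only [hP, errIntegrand_eq_add]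
      rw [intervalIntegral.integral_add hE hS, intervalIntegral.integral_const_mul,
        intervalIntegral.integral_finsetSum hφ']
      simp only [intervalIntegral.integral_const_mul, hQ, he, ζ, ξ]
    rw [this, add_sub_cancel_right]
  have first : |∫ y in c..d, (P y - Q y)| ≤ Bx * ∫ y in c..d, weight γ ζ y := by
    rw [← intervalIntegral.integral_const_mul, ← Real.norm_eq_abs]
    refine intervalIntegral.norm_integral_le_of_norm_le hcd.le
      (Filter.Eventually.of_forall fun y hy => ?_)
      ((weight_intervalIntegrable hγ ζ _ _).const_mul _)
    have hy' : y ∈ Icc c d := ⟨hy.1.le, hy.2⟩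
    rw [hPQ y hy', Real.norm_eq_abs, abs_mul, abs_of_nonneg (weight_nonneg _ _ _), mul_comm]
    exact mul_le_mul_of_nonneg_right (hBx y hy') (weight_nonneg _ _ _)
  have hBy0 : 0 ≤ By := (abs_nonneg _).trans (hBy a ⟨le_rfl, hab.le⟩)
  have second : |∫ y in c..d, Q y| ≤ 3 * (∫ x in a..b, weight γ ξ x) * By := by
    rw [hQ, intervalIntegral.integral_finsetSum fun l hl => (heint l hl).mul_const _]
    simp only [intervalIntegral.integral_mul_const]
    refine (Finset.abs_sum_le_sum_abs _ _).trans ?_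
    refine le_trans (Finset.sum_le_sum fun l hl => ?_)
      ((Finset.sum_mul _ _ _).symm.le.trans (mul_le_mul_of_nonneg_right
        (sum_abs_integral_basisFun_le hγ hab hMx ξ) hBy0))
    rw [abs_mul, mul_comm]
    exact mul_le_mul_of_nonneg_left (hBy _ (hnode l hl)) (abs_nonneg _)
  have split : ∫ y in c..d, P y = (∫ y in c..d, (P y - Q y)) + ∫ y in c..d, Q y := by
    rw [intervalIntegral.integral_sub hPint hQint, sub_add_cancel]
  rw [split]
  exact (abs_add_le _ _).trans (add_le_add first second)

end PQC

/-! ### Assembly. -/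

theorem lemma3p9 (γ : ℝ) (hγ0 : 0 < γ) (hγ1 : γ < 1) (a b c d : ℝ) (hab : a < b) (hcd : c < d)
    (u : ℝ → ℝ → ℝ)
    (hu : ContDiffOn ℝ 6 (fun p : ℝ × ℝ => u p.1 p.2) (Set.Icc a b ×ˢ Set.Icc c d)) :
    ∃ C : ℝ, ∀ Mx My : ℕ, 1 ≤ Mx → 1 ≤ My →
      ∀ i j : ℕ, 1 ≤ i → i < 2 * Mx → 1 ≤ j → j < 2 * My →
        MeasureTheory.IntegrableOn
            (fun p : ℝ × ℝ => PQC.errIntegrand γ a b c d u Mx My i j p.1 p.2)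
            (Set.Icc a b ×ˢ Set.Icc c d) MeasureTheory.volume ∧
        |∫ y in c..d, ∫ x in a..b, PQC.errIntegrand γ a b c d u Mx My i j x y| ≤
          C * (PQC.step a b Mx ^ 4 * PQC.eta a b Mx i ^ (-γ) +
               PQC.step c d My ^ 4 * PQC.eta c d My j ^ (-γ)) +
          C * (PQC.step a b Mx ^ (5 - γ) + PQC.step c d My ^ (5 - γ)) := by
  have hswap : ContDiffOn ℝ 6 (fun p : ℝ × ℝ => u p.2 p.1) (Set.Icc c d ×ˢ Set.Icc a b) :=
    hu.comp (f := Prod.swap) (contDiff_snd.prodMk contDiff_fst).contDiffOn fun p hp => ⟨hp.2, hp.1⟩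
  obtain ⟨Kx, hKx0, hKx⟩ := PQC.exists_thirdDerivControl hab hcd hu
  obtain ⟨Ky, hKy0, hKy⟩ := PQC.exists_thirdDerivControl hcd hab hswap
  obtain ⟨Cx, hCx0, hCx⟩ := PQC.exists_abs_integral_sub_interp₁_le hγ0 hγ1 hab
  obtain ⟨Cy, hCy0, hCy⟩ := PQC.exists_abs_integral_sub_interp₁_le hγ0 hγ1 hcd
  set Wx := ∫ s in (-(b - a))..(b - a), |s| ^ (-γ)
  set Wy := ∫ s in (-(d - c))..(d - c), |s| ^ (-γ)
  have hWx0 : 0 ≤ Wx := intervalIntegral.integral_nonneg (by linarith) fun s _ =>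
    Real.rpow_nonneg (abs_nonneg _) _
  have hWy0 : 0 ≤ Wy := intervalIntegral.integral_nonneg (by linarith) fun s _ =>
    Real.rpow_nonneg (abs_nonneg _) _
  refine ⟨Cx * Kx * Wy + 3 * Wx * (Cy * Ky), fun Mx My hMx hMy i j hi hiM hj hjM => ⟨?_, ?_⟩⟩
  · have := PQC.integrable_errIntegrand hγ1 hab hcd hu.continuousOn hMx hMy i j
    rwa [MeasureTheory.Measure.prod_restrict] at this
  have bound := PQC.abs_integral_errIntegrand_le hγ1 hab hcd hu.continuousOn hMx hMy
    (i := i) (j := j)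
    (fun y hy => by
      obtain ⟨g₁, g₂, g₃, H⟩ := hKx y hy
      exact hCx Kx _ _ _ _ H Mx i hMx hi hiM)
    (fun x hx => by
      obtain ⟨g₁, g₂, g₃, H⟩ := hKy x hx
      exact hCy Ky _ _ _ _ H My j hMy hj hjM)
  refine bound.trans ?_
  have hwx := PQC.integral_weight_le hγ1 (PQC.node_mem_Icc hab hMx hiM.le)
  have hwy := PQC.integral_weight_le hγ1 (PQC.node_mem_Icc hcd hMy hjM.le)
  have hx0 : 0 ≤ PQC.step a b Mx ^ 4 * PQC.eta a b Mx i ^ (-γ) :=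
    mul_nonneg (by positivity) (Real.rpow_nonneg (PQC.eta_pos hab hMx hi hiM).le _)
  have hy0 : 0 ≤ PQC.step c d My ^ 4 * PQC.eta c d My j ^ (-γ) :=
    mul_nonneg (by positivity) (Real.rpow_nonneg (PQC.eta_pos hcd hMy hj hjM).le _)
  have hsx : 0 ≤ PQC.step a b Mx ^ (5 - γ) := Real.rpow_nonneg (PQC.step_pos hab hMx).le _
  have hsy : 0 ≤ PQC.step c d My ^ (5 - γ) := Real.rpow_nonneg (PQC.step_pos hcd hMy).le _
  set X := PQC.step a b Mx ^ 4 * PQC.eta a b Mx i ^ (-γ)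
  set Y := PQC.step c d My ^ 4 * PQC.eta c d My j ^ (-γ)
  calc _ ≤ Cx * Kx * X * Wy + 3 * Wx * (Cy * Ky * Y) := by gcongr
    -- Nonnegative cross terms are added so that `X` and `Y` share one constant.
    _ ≤ Cx * Kx * X * Wy + 3 * Wx * (Cy * Ky * Y) +
        (Cx * Kx * Wy * Y + 3 * Wx * (Cy * Ky) * X) := le_add_of_nonneg_right (by positivity)
    _ = (Cx * Kx * Wy + 3 * Wx * (Cy * Ky)) * (X + Y) := by ring
    _ ≤ _ := le_add_of_nonneg_right (by positivity)
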